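/- Let $(X,\mu)$ be a probability space with a measure-preserving action of $\mathbb{Z}^2$, and for $g\in\mathbb{Z}^2$ and $h\in L^2(X,\mu)$ (complex-valued) write $(u^g\cdot h)(x)=h(g^{-1}\cdot x)$. Let $R=\mathbb{Z}[u_1^{\pm1},u_2^{\pm1}]$ be the ring of Laurent polynomials, written as finite sums $p=\sum_{g} c_g u^g$ with $g\in\mathbb{Z}^2$, $c_g\in\mathbb{Z}$, acting on $L^2(X,\mu)$ by $p\cdot h=\sum_g c_g\,(u^g\cdot h)$, and put $\mathrm{Ann}(h)=\{p\in R: p\cdot h=0\}$. For $g\in\mathbb{Z}^2$ let $H_g=\{h\in L^2(X,\mu): u^g\cdot h=h\}$, and for $f\in L^2(X,\mu)$ let $f^g$ be the orthogonal projection of $f$ onto $H_g$. Call $h\in L^2(X,\mu)$ periodic if $\{g\in\mathbb{Z}^2: u^g\cdot h=h\}$ is a finite index subgroup of $\mathbb{Z}^2$. Call $g,h\in\mathbb{Z}^2$ proportional if $qg=rh$ for some nonzero integers $q,r$. Let $f\in L^\infty(X,\mu)$ be integer-valued (almost everywhere) with $\mathrm{Ann}(f)\neq\{0\}$. Then there exists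 a finite set $\Delta\subset\mathbb{Z}^2\setminus\{0\}$ such that 1. no two distinct elements of $\Delta$ are proportional to each other; 2. the function $f_0=f-\sum_{g\in\Delta}f^g$ is periodic; 3. for every integer $l\ge 1$ and every $g\in\Delta$, the function $f^{lg}-f^g$ is periodic. -/

import Mathlib

open MeasureTheory
open scoped ENNReal

noncomputable section

namespace PlaneAction

/-- Two vectors of `ℤ²` are proportional if they have a common nonzero-integer multiple,
i.e. `q g = r h` for some nonzero integers `q`, `r`. -/
def Proportional (g h : ℤ × ℤ) : Prop :=
  ∃ q r : ℤ, q ≠ 0 ∧ r ≠ 0 ∧ q • g = r • h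

/-- The ring `ℤ[u₁^±1, u₂^±1]`: finite sums `∑ c_g u^g` with `g ∈ ℤ²`, `c_g ∈ ℤ`, and
`u^g u^h = u^(g+h)`. -/
abbrev LaurentRing : Type := AddMonoidAlgebra ℤ (ℤ × ℤ)

variable {X : Type*} [MeasurableSpace X] [AddAction (ℤ × ℤ) X] [MeasurableConstVAdd (ℤ × ℤ) X]
  (μ : Measure X) [VAddInvariantMeasure (ℤ × ℤ) X μ]

/-- Translation `u^g · f` of `f ∈ L²(X, μ)`, that is `(u^g · f)(x) = f(g⁻¹ · x)`. -/
def koopman (g : ℤ × ℤ) : Lp ℂ 2 μ →L[ℂ] Lp ℂ 2 μ :=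
  (Lp.compMeasurePreservingₗᵢ ℂ (fun x : X => (-g) +ᵥ x)
    (measurePreserving_vadd (-g) μ)).toContinuousLinearMap

theorem coeFn_koopman (g : ℤ × ℤ) (f : Lp ℂ 2 μ) :
    koopman μ g f =ᵐ[μ] fun x => f ((-g) +ᵥ x) :=
  Lp.coeFn_compMeasurePreserving f (measurePreserving_vadd (-g) μ)

theorem koopman_zero (f : Lp ℂ 2 μ) : koopman μ 0 f = f := by
  apply Lp.ext
  filter_upwards [coeFn_koopman μ 0 f] with x hx
  simpa using hx

theorem koopman_add (g h : ℤ × ℤ) (f : Lp ℂ 2 μ) :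
    koopman μ (g + h) f = koopman μ g (koopman μ h f) := by
  apply Lp.ext
  have h1 := (measurePreserving_vadd (-g) μ).quasiMeasurePreserving.ae (coeFn_koopman μ h f)
  filter_upwards [coeFn_koopman μ (g + h) f, coeFn_koopman μ g (koopman μ h f), h1]
    with x hx hy hz
  rw [hx, hy, hz, ← add_vadd]
  congr 2
  abel

/-- The action `p · f = ∑_g c_g (u^g · f)` of `p = ∑_g c_g u^g` on `f ∈ L²(X, μ)`. -/
def laurentAct (p : LaurentRing) (f : Lp ℂ 2 μ) : Lp ℂ 2 μ :=
  p.coeff.sum fun g c => c • koopman μ g f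

theorem laurentAct_add (p q : LaurentRing) (f : Lp ℂ 2 μ) :
    laurentAct μ (p + q) f = laurentAct μ p f + laurentAct μ q f := by
  unfold laurentAct
  rw [AddMonoidAlgebra.coeff_add]
  exact Finsupp.sum_add_index' (fun _ => zero_smul _ _) (fun _ _ _ => add_smul _ _ _)

theorem laurentAct_single (g : ℤ × ℤ) (c : ℤ) (f : Lp ℂ 2 μ) :
    laurentAct μ (AddMonoidAlgebra.single g c) f = c • koopman μ g f := by
  unfold laurentAct
  exact Finsupp.sum_single_index (zero_smul _ _)

theorem laurentAct_single_mul (g : ℤ × ℤ) (c : ℤ) (q : LaurentRing) (f : Lp ℂ 2 μ) :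
    laurentAct μ (AddMonoidAlgebra.single g c * q) f = c • koopman μ g (laurentAct μ q f) := by
  induction q using AddMonoidAlgebra.induction_linear with
  | zero => simp [laurentAct]
  | add p q hp hq => rw [mul_add, laurentAct_add, laurentAct_add, hp, hq, map_add, smul_add]
  | single h d =>
    rw [AddMonoidAlgebra.single_mul_single, laurentAct_single, laurentAct_single, koopman_add,
      mul_smul, map_zsmul]

theorem laurentAct_mul (p q : LaurentRing) (f : Lp ℂ 2 μ) :
    laurentAct μ (p * q) f = laurentAct μ p (laurentAct μ q f) := by
  induction p using AddMonoidAlgebra.induction_linear with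
  | zero => simp [laurentAct]
  | add p r hp hr => rw [add_mul, laurentAct_add, laurentAct_add, hp, hr]
  | single g c =>
    rw [laurentAct_single_mul, laurentAct_single]

/-- `Ann(f) = {p : p · f = 0}`, an ideal of the ring of Laurent polynomials. -/
def annihilator (f : Lp ℂ 2 μ) : Ideal LaurentRing where
  carrier := {p | laurentAct μ p f = 0}
  zero_mem' := by simp [laurentAct]
  add_mem' := by
    intro p q hp hq
    have hp' : laurentAct μ p f = 0 := hp
    have hq' : laurentAct μ q f = 0 := hq
    change laurentAct μ (p + q) f = 0
    rw [laurentAct_add, hp', hq', add_zero]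
  smul_mem' := by
    intro p q hq
    have hq' : laurentAct μ q f = 0 := hq
    change laurentAct μ (p * q) f = 0
    rw [laurentAct_mul, hq']
    simp [laurentAct]

/-- The closed subspace `H_g = {h ∈ L²(X, μ) : u^g · h = h}` of `g`-invariant functions. -/
def invariantSubspace (g : ℤ × ℤ) : Submodule ℂ (Lp ℂ 2 μ) :=
  (koopman μ g).eqLocus (1 : Lp ℂ 2 μ →L[ℂ] Lp ℂ 2 μ)

instance (g : ℤ × ℤ) : CompleteSpace (invariantSubspace μ g) :=
  inferInstanceAs (CompleteSpace ((koopman μ g).eqLocus (1 : Lp ℂ 2 μ →L[ℂ] Lp ℂ 2 μ)))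

/-- `f^g`, the orthogonal projection of `f ∈ L²(X, μ)` onto `H_g`. -/
def invariantPart (g : ℤ × ℤ) (f : Lp ℂ 2 μ) : Lp ℂ 2 μ :=
  (invariantSubspace μ g).starProjection f

/-- The stabilizer `{g ∈ ℤ² : u^g · f = f}` of `f ∈ L²(X, μ)`. -/
def stabilizer (f : Lp ℂ 2 μ) : AddSubgroup (ℤ × ℤ) where
  carrier := {g | koopman μ g f = f}
  zero_mem' := koopman_zero μ f
  add_mem' := by
    intro g h hg hh
    have hg' : koopman μ g f = f := hg
    have hh' : koopman μ h f = f := hh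
    change koopman μ (g + h) f = f
    rw [koopman_add, hh', hg']
  neg_mem' := by
    intro g hg
    have hg' : koopman μ g f = f := hg
    change koopman μ (-g) f = f
    nth_rewrite 1 [← hg']
    rw [← koopman_add, neg_add_cancel, koopman_zero]

/-- `f ∈ L²(X, μ)` is periodic if its stabilizer has finite index in `ℤ²`. -/
def IsPeriodic (f : Lp ℂ 2 μ) : Prop :=
  (stabilizer μ f).FiniteIndex

end PlaneAction

end

/-!
The proof combines the dilation trick of the theory of translational tilings with von Neumann's
mean ergodic theorem.

Let `p · f = 0` with `p ≠ 0`, and write `p(u^n)` for `∑ c_g u^{ng}`. For a prime `q` one has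
`p(u^q) ≡ p^q` modulo `q`, so `p(u^q) · f` takes values in `qℤ`. It is also bounded independently
of `q`, so it vanishes for all large primes `q`. Iterating, `p(u^n) · f = 0` for every `n ≠ 0` all
of whose prime factors are large (`laurentAct_dilate_eq_zero`), in particular for `n = 1 + kN` with
`N` a suitable factorial. Averaging over `k`, the mean ergodic theorem turns `u^{kNg}` into the
projection onto `H_{Ng}` (`tendsto_average_laurentAct_dilate`). After multiplying `p` by a monomial
to make its constant coefficient nonzero, the resulting relation `∑ c_g u^g · f^{Ng} = 0` expresses
`f` as a finite sum of vectors fixed by nonzero elements of `ℤ²`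
(`exists_eq_sum_of_annihilator_ne_bot`).

Merging proportional directions gives `f = ∑_{g ∈ Δ} h_g` with `h_g ∈ H_g` and `Δ` pairwise
non-proportional (`exists_nonproportional_decomposition`). The projections commute with the action,
so for `g ≠ g'` in `Δ` and `m ≥ 1` the projection of `h_{g'}` to `H_{mg}` is fixed by both `mg` and
`g'`, hence periodic, while `h_g` itself is fixed by `mg`. So `f^{mg} - h_g` is periodic for all
`m ≥ 1` (`isPeriodic_invariantPart_sub`), and both periodicity claims follow.
-/

open Filter Topology

namespace PlaneAction

noncomputable section

variable {X : Type*} [MeasurableSpace X] [AddAction (ℤ × ℤ) X] [MeasurableConstVAdd (ℤ × ℤ) X]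
  (μ : Measure X) [VAddInvariantMeasure (ℤ × ℤ) X μ]

/-! ### Proportional vectors -/

theorem Proportional.symm {g h : ℤ × ℤ} : Proportional g h → Proportional h g := by
  rintro ⟨q, r, hq, hr, e⟩
  exact ⟨r, q, hr, hq, e.symm⟩

theorem Proportional.trans {g h k : ℤ × ℤ} :
    Proportional g h → Proportional h k → Proportional g k := by
  rintro ⟨q, r, hq, hr, e⟩ ⟨s, t, hs, ht, e'⟩
  refine ⟨s * q, r * t, mul_ne_zero hs hq, mul_ne_zero hr ht, ?_⟩
  rw [mul_smul, e, mul_smul, ← e', smul_comm]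

theorem proportional_smul_left {r : ℤ} (hr : r ≠ 0) (g : ℤ × ℤ) : Proportional (r • g) g :=
  ⟨1, r, one_ne_zero, hr, by rw [one_smul]⟩

theorem det_ne_zero_of_not_proportional {g h : ℤ × ℤ} (hg : g ≠ 0) (hh : h ≠ 0)
    (hgh : ¬ Proportional g h) : g.1 * h.2 - g.2 * h.1 ≠ 0 := by
  obtain ⟨a, b⟩ := g
  obtain ⟨c, d⟩ := h
  intro hdet
  simp only [ne_eq, Prod.mk_eq_zero, not_and] at hg hh hdet
  have hdet' : a * d = b * c := by linarith
  by_cases h1 : a ≠ 0 ∧ c ≠ 0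
  · exact hgh ⟨c, a, h1.2, h1.1, by ext <;> simp <;> linarith⟩
  by_cases h2 : b ≠ 0 ∧ d ≠ 0
  · exact hgh ⟨d, b, h2.2, h2.1, by ext <;> simp <;> linarith⟩
  rcases eq_or_ne a 0 with rfl | ha
  · have hb := hg rfl
    have hc : c = 0 := by simpa [hb] using hdet'.symm
    exact h2 ⟨hb, hh hc⟩
  · have hc : c = 0 := by_contra fun hc => h1 ⟨ha, hc⟩
    have hd := hh hc
    simp [hc, ha, hd] at hdet'

theorem finiteIndex_of_mem_of_not_proportional {S : AddSubgroup (ℤ × ℤ)} {g h : ℤ × ℤ}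
    (hgS : g ∈ S) (hhS : h ∈ S) (hg : g ≠ 0) (hh : h ≠ 0) (hgh : ¬ Proportional g h) :
    S.FiniteIndex := by
  have hD := det_ne_zero_of_not_proportional hg hh hgh
  set D := g.1 * h.2 - g.2 * h.1 with hDdef
  have : NeZero D.natAbs := ⟨Int.natAbs_ne_zero.mpr hD⟩
  let φ : ℤ × ℤ →+ ZMod D.natAbs × ZMod D.natAbs :=
    (Int.castAddHom _).prodMap (Int.castAddHom _)
  have : φ.ker ≤ S := by
    rintro ⟨x, y⟩ hxy
    have hxy' : (x : ZMod D.natAbs) = 0 ∧ (y : ZMod D.natAbs) = 0 := by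
      simpa [φ, AddMonoidHom.mem_ker] using hxy
    simp only [ZMod.intCast_zmod_eq_zero_iff_dvd, Int.natAbs_dvd] at hxy'
    obtain ⟨⟨x, rfl⟩, ⟨y, rfl⟩⟩ := hxy'
    -- Cramer's rule
    have : (D * x, D * y) = (x * h.2 - y * h.1) • g + (y * g.1 - x * g.2) • h := by
      ext <;> simp [hDdef] <;> ring
    rw [this]
    exact S.add_mem (S.zsmul_mem hgS _) (S.zsmul_mem hhS _)
  exact AddSubgroup.finiteIndex_of_le this

/-! ### Periodic vectors -/

/-- The periodic elements of `L²(X, μ)`, as an additive subgroup. -/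
def periodicSubgroup : AddSubgroup (Lp ℂ 2 μ) where
  carrier := {f | IsPeriodic μ f}
  zero_mem' := by
    have : stabilizer μ 0 = ⊤ := by
      ext g
      exact iff_of_true (map_zero (koopman μ g)) trivial
    change (stabilizer μ 0).FiniteIndex
    rw [this]
    infer_instance
  add_mem' := by
    intro f f' (hf : (stabilizer μ f).FiniteIndex) (hf' : (stabilizer μ f').FiniteIndex)
    have : stabilizer μ f ⊓ stabilizer μ f' ≤ stabilizer μ (f + f') := by
      rintro g ⟨h1 : koopman μ g f = f, h2 : koopman μ g f' = f'⟩
      change koopman μ g (f + f') = f + f'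
      rw [map_add, h1, h2]
    exact AddSubgroup.finiteIndex_of_le this
  neg_mem' := by
    intro f (hf : (stabilizer μ f).FiniteIndex)
    have : stabilizer μ f ≤ stabilizer μ (-f) := by
      intro g (h1 : koopman μ g f = f)
      change koopman μ g (-f) = -f
      rw [map_neg, h1]
    exact AddSubgroup.finiteIndex_of_le this

variable {μ} in
theorem koopman_zsmul_eq_self {g : ℤ × ℤ} {f : Lp ℂ 2 μ} (h : koopman μ g f = f) (n : ℤ) :
    koopman μ (n • g) f = f :=
  (stabilizer μ f).zsmul_mem h n

/-! ### Invariant projections and the mean ergodic theorem -/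

theorem koopman_nsmul (n : ℕ) (g : ℤ × ℤ) (f : Lp ℂ 2 μ) :
    koopman μ (n • g) f = (koopman μ g)^[n] f := by
  induction n with
  | zero => simp [koopman_zero]
  | succ n ih => rw [succ_nsmul', koopman_add, ih, Function.iterate_succ_apply']

theorem koopman_comm (g h : ℤ × ℤ) (f : Lp ℂ 2 μ) :
    koopman μ g (koopman μ h f) = koopman μ h (koopman μ g f) := by
  rw [← koopman_add, add_comm, koopman_add]

/-- The mean ergodic theorem for the single operator `u^g`. -/
theorem tendsto_average_koopman (g : ℤ × ℤ) (f : Lp ℂ 2 μ) :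
    Tendsto (fun n : ℕ => (n : ℂ)⁻¹ • ∑ k ∈ Finset.range n, koopman μ (k • g) f) atTop
      (𝓝 (invariantPart μ g f)) := by
  have h := ContinuousLinearMap.tendsto_birkhoffAverage_orthogonalProjection (koopman μ g)
    (LinearIsometry.norm_toContinuousLinearMap_le _) f
  refine h.congr fun n => ?_
  simp only [birkhoffAverage, birkhoffSum, koopman_nsmul, id_eq]

theorem koopman_invariantPart_self (g : ℤ × ℤ) (f : Lp ℂ 2 μ) :
    koopman μ g (invariantPart μ g f) = invariantPart μ g f :=
  (invariantSubspace μ g).starProjection_apply_mem f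

theorem invariantPart_eq_self {g : ℤ × ℤ} {f : Lp ℂ 2 μ} (h : koopman μ g f = f) :
    invariantPart μ g f = f :=
  Submodule.starProjection_eq_self_iff.mpr h

theorem koopman_invariantPart (g h : ℤ × ℤ) (f : Lp ℂ 2 μ) :
    koopman μ h (invariantPart μ g f) = invariantPart μ g (koopman μ h f) := by
  refine tendsto_nhds_unique
    (((koopman μ h).continuous.tendsto _).comp (tendsto_average_koopman μ g f))
    ((tendsto_average_koopman μ g (koopman μ h f)).congr fun n => ?_)
  simp [map_sum, koopman_comm μ h]

/-! ### Dilation of Laurent polynomials -/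

/-- The dilation `p(u^n) = ∑ c_g u^{ng}` of a Laurent polynomial `p = ∑ c_g u^g`. -/
def dilate (n : ℕ) (p : LaurentRing) : LaurentRing :=
  AddMonoidAlgebra.mapDomain (fun g => n • g) p

theorem dilate_add (n : ℕ) (p q : LaurentRing) : dilate n (p + q) = dilate n p + dilate n q :=
  AddMonoidAlgebra.mapDomain_add ..

theorem dilate_zero (n : ℕ) : dilate n 0 = 0 :=
  AddMonoidAlgebra.mapDomain_zero _

theorem dilate_single (n : ℕ) (g : ℤ × ℤ) (c : ℤ) :
    dilate n (AddMonoidAlgebra.single g c) = AddMonoidAlgebra.single (n • g) c :=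
  AddMonoidAlgebra.mapDomain_single

theorem dilate_dilate (m n : ℕ) (p : LaurentRing) : dilate m (dilate n p) = dilate (m * n) p := by
  induction p using AddMonoidAlgebra.induction_linear with
  | zero => simp only [dilate_zero]
  | add p q hp hq => simp only [dilate_add, hp, hq]
  | single g c => simp only [dilate_single, mul_smul]

theorem dilate_one (p : LaurentRing) : dilate 1 p = p := by
  induction p using AddMonoidAlgebra.induction_linear with
  | zero => exact dilate_zero 1
  | add p q hp hq => rw [dilate_add, hp, hq]
  | single g c => rw [dilate_single, one_smul]

/-- The Frobenius congruence `p^q ≡ p(u^q)` modulo a prime `q`. -/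
theorem exists_pow_prime_eq_dilate_add {q : ℕ} (hq : q.Prime) (p : LaurentRing) :
    ∃ r : LaurentRing, p ^ q = dilate q p + (q : ℤ) • r := by
  induction p using AddMonoidAlgebra.induction_linear with
  | zero => exact ⟨0, by simp [dilate_zero, hq.ne_zero]⟩
  | add a b ha hb =>
    obtain ⟨r, hr⟩ := ha
    obtain ⟨s, hs⟩ := hb
    obtain ⟨t, ht⟩ := exists_add_pow_prime_eq hq a b
    refine ⟨r + s + a * b * t, ?_⟩
    rw [ht, hr, hs, dilate_add]
    simp only [zsmul_eq_mul, Int.cast_natCast]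
    ring
  | single g c =>
    have := Fact.mk hq
    obtain ⟨d, hd⟩ : (q : ℤ) ∣ c ^ q - c := by
      rw [← ZMod.intCast_zmod_eq_zero_iff_dvd]
      simp
    refine ⟨AddMonoidAlgebra.single (q • g) d, ?_⟩
    rw [AddMonoidAlgebra.single_pow, dilate_single, AddMonoidAlgebra.smul_single,
      ← AddMonoidAlgebra.single_add, smul_eq_mul, ← hd, add_sub_cancel]

/-! ### Integrality and vanishing of dilates -/

variable {μ}

theorem ae_int_laurentAct {f : Lp ℂ 2 μ} (hf : ∀ᵐ x ∂μ, ∃ n : ℤ, f x = n) (p : LaurentRing) :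
    ∀ᵐ x ∂μ, ∃ n : ℤ, laurentAct μ p f x = n := by
  induction p using AddMonoidAlgebra.induction_linear with
  | zero =>
    have : laurentAct μ 0 f = 0 := by simp [laurentAct]
    rw [this]
    filter_upwards [Lp.coeFn_zero ℂ 2 μ] with x hx
    exact ⟨0, by rw [hx, Pi.zero_apply, Int.cast_zero]⟩
  | add p q hp hq =>
    rw [laurentAct_add]
    filter_upwards [hp, hq, Lp.coeFn_add (laurentAct μ p f) (laurentAct μ q f)]
      with x ⟨m, hm⟩ ⟨n, hn⟩ hx
    exact ⟨m + n, by rw [hx, Pi.add_apply, hm, hn, Int.cast_add]⟩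
  | single g c =>
    rw [laurentAct_single, ← Int.cast_smul_eq_zsmul ℂ]
    have h1 := (measurePreserving_vadd (-g) μ).quasiMeasurePreserving.ae hf
    filter_upwards [h1, coeFn_koopman μ g f, Lp.coeFn_smul (c : ℂ) (koopman μ g f)]
      with x ⟨n, hn⟩ hx hy
    exact ⟨c * n, by rw [hy, Pi.smul_apply, hx, hn, smul_eq_mul, Int.cast_mul]⟩

/-- The dilates `p(u^n) · f` of a bounded `f` are bounded uniformly in `n`. -/
theorem exists_ae_bound_laurentAct_dilate {f : Lp ℂ 2 μ} (hf : MemLp f ∞ μ) (p : LaurentRing) :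
    ∃ C : ℝ, ∀ n : ℕ, ∀ᵐ x ∂μ, ‖laurentAct μ (dilate n p) f x‖ ≤ C := by
  induction p using AddMonoidAlgebra.induction_linear with
  | zero =>
    refine ⟨0, fun n => ?_⟩
    have : laurentAct μ (dilate n 0) f = 0 := by simp [laurentAct, dilate_zero]
    rw [this]
    filter_upwards [Lp.coeFn_zero ℂ 2 μ] with x hx
    rw [hx, Pi.zero_apply, norm_zero]
  | add p q hp hq =>
    obtain ⟨C, hC⟩ := hp
    obtain ⟨D, hD⟩ := hq
    refine ⟨C + D, fun n => ?_⟩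
    rw [dilate_add, laurentAct_add]
    filter_upwards [hC n, hD n,
      Lp.coeFn_add (laurentAct μ (dilate n p) f) (laurentAct μ (dilate n q) f)] with x h1 h2 hx
    rw [hx]
    exact (norm_add_le _ _).trans (add_le_add h1 h2)
  | single g c =>
    refine ⟨‖(c : ℂ)‖ * (eLpNormEssSup f μ).toReal, fun n => ?_⟩
    rw [dilate_single, laurentAct_single, ← Int.cast_smul_eq_zsmul ℂ]
    have hfin : eLpNormEssSup f μ ≠ ∞ := by simpa using hf.eLpNorm_ne_top
    have h0 : ∀ᵐ x ∂μ, ‖f x‖ ≤ (eLpNormEssSup f μ).toReal := by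
      filter_upwards [ae_le_eLpNormEssSup (f := f) (μ := μ)] with x hx
      simpa using ENNReal.toReal_mono hfin hx
    have h1 := (measurePreserving_vadd (-(n • g)) μ).quasiMeasurePreserving.ae h0
    filter_upwards [h1, coeFn_koopman μ (n • g) f, Lp.coeFn_smul (c : ℂ) (koopman μ (n • g) f)]
      with x h1 hx hy
    rw [hy, Pi.smul_apply, hx, norm_smul]
    gcongr

/-- If `p` annihilates the integer-valued `f`, then `p(u^q) · f` is a multiple of the prime `q`, so
it vanishes as soon as it is bounded by some `C < q`. -/
theorem laurentAct_dilate_prime_eq_zero {f : Lp ℂ 2 μ} (hf : ∀ᵐ x ∂μ, ∃ n : ℤ, f x = n)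
    {p : LaurentRing} (hp : laurentAct μ p f = 0) {q : ℕ} (hq : q.Prime) {C : ℝ} (hCq : C < q)
    (hC : ∀ᵐ x ∂μ, ‖laurentAct μ (dilate q p) f x‖ ≤ C) : laurentAct μ (dilate q p) f = 0 := by
  obtain ⟨r, hr⟩ := exists_pow_prime_eq_dilate_add hq p
  have hpow : p ^ q ∈ annihilator μ f := Ideal.pow_mem_of_mem _ hp q hq.pos
  have hmul : laurentAct μ ((q : ℤ) • r) f = ((q : ℤ) : ℂ) • laurentAct μ r f := by
    have : (q : ℤ) • r = AddMonoidAlgebra.single 0 (q : ℤ) * r := by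
      exact Algebra.smul_def (q : ℤ) r
    rw [this, laurentAct_single_mul, koopman_zero, Int.cast_smul_eq_zsmul]
  have key : laurentAct μ (dilate q p) f = -(((q : ℤ) : ℂ) • laurentAct μ r f) := by
    have h : laurentAct μ (p ^ q) f = 0 := hpow
    rw [hr, laurentAct_add, hmul] at h
    exact eq_neg_of_add_eq_zero_left h
  rw [Lp.eq_zero_iff_ae_eq_zero]
  rw [key] at hC ⊢
  filter_upwards [hC, ae_int_laurentAct hf r, Lp.coeFn_neg (((q : ℤ) : ℂ) • laurentAct μ r f),
    Lp.coeFn_smul ((q : ℤ) : ℂ) (laurentAct μ r f)] with x hx ⟨n, hn⟩ h1 h2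
  rw [h1, Pi.neg_apply, h2, Pi.smul_apply, hn] at hx ⊢
  have hn0 : n = 0 := by
    by_contra hn0
    have hn1 : (1 : ℝ) ≤ ‖(n : ℂ)‖ := by
      rw [Complex.norm_intCast]
      exact_mod_cast Int.one_le_abs hn0
    rw [norm_neg, norm_smul] at hx
    simp only [Int.cast_natCast, Complex.norm_natCast] at hx
    have : (q : ℝ) * 1 ≤ q * ‖(n : ℂ)‖ := by gcongr
    linarith
  simp [hn0]

/-- Induction on the prime factorization of `n`; the bound `C` stays the same along the way because
it is uniform over all dilates of `p`. -/
theorem laurentAct_dilate_eq_zero {f : Lp ℂ 2 μ} (hf : ∀ᵐ x ∂μ, ∃ n : ℤ, f x = n)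
    {p : LaurentRing} (hp : laurentAct μ p f = 0) {C : ℝ}
    (hC : ∀ n : ℕ, ∀ᵐ x ∂μ, ‖laurentAct μ (dilate n p) f x‖ ≤ C) (n : ℕ) (hn0 : n ≠ 0)
    (hn : ∀ q : ℕ, q.Prime → q ∣ n → C < q) : laurentAct μ (dilate n p) f = 0 := by
  induction n using induction_on_primes with
  | zero => exact absurd rfl hn0
  | one => rwa [dilate_one]
  | prime_mul q n hq ih =>
    have hn' := ih (right_ne_zero_of_mul hn0) fun q' hq' h => hn q' hq' (h.mul_left q)
    rw [← dilate_dilate]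
    refine laurentAct_dilate_prime_eq_zero hf hn' hq (hn q hq (dvd_mul_right q n)) ?_
    rw [dilate_dilate]
    exact hC _

/-! ### Averaging the dilates -/

/-- Averaging `u^{(1+kN)g} = u^g (u^{Ng})^k` over `k` replaces the powers of `u^{Ng}` by the
projection onto `H_{Ng}`. -/
theorem tendsto_average_laurentAct_dilate (N : ℕ) (f : Lp ℂ 2 μ) (p : LaurentRing) :
    Tendsto (fun n : ℕ => (n : ℂ)⁻¹ • ∑ k ∈ Finset.range n, laurentAct μ (dilate (1 + k * N) p) f)
      atTop (𝓝 (p.coeff.sum fun g c => c • koopman μ g (invariantPart μ (N • g) f))) := by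
  induction p using AddMonoidAlgebra.induction_linear with
  | zero => simp [laurentAct, dilate_zero]
  | add p q hp hq =>
    rw [AddMonoidAlgebra.coeff_add,
      Finsupp.sum_add_index' (fun _ => by exact zero_smul _ _)
        (fun _ _ _ => by exact add_smul _ _ _)]
    refine (hp.add hq).congr fun n => ?_
    simp only [dilate_add, laurentAct_add, Finset.sum_add_distrib, smul_add]
  | single g c =>
    rw [AddMonoidAlgebra.coeff_single, Finsupp.sum_single_index (by exact zero_smul _ _)]
    refine ((((koopman μ g).continuous.tendsto _).comp
      (tendsto_average_koopman μ (N • g) f)).const_smul c).congr fun n => ?_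
    simp only [Function.comp_apply, map_smul, map_sum, dilate_single, laurentAct_single,
      ← Finset.smul_sum, add_smul, one_smul, koopman_add, mul_smul]
    rw [smul_comm]

theorem exists_mem_annihilator_coeff_zero_ne_zero {f : Lp ℂ 2 μ} (hf : annihilator μ f ≠ ⊥) :
    ∃ p : LaurentRing, laurentAct μ p f = 0 ∧ p.coeff 0 ≠ 0 := by
  obtain ⟨p, hp : laurentAct μ p f = 0, hp0⟩ := Submodule.exists_mem_ne_zero_of_ne_bot hf
  obtain ⟨g, hg⟩ : ∃ g, p.coeff g ≠ 0 := by
    by_contra! h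
    exact hp0 (by ext g; simp [h g])
  refine ⟨AddMonoidAlgebra.single (-g) 1 * p, ?_, ?_⟩
  · rw [laurentAct_mul, hp]
    simp [laurentAct]
  · simpa using hg

/-- A bounded integer-valued function with nonzero annihilator is a finite sum of vectors, each of
them fixed by some nonzero element of `ℤ²`. -/
theorem exists_eq_sum_of_annihilator_ne_bot {f : Lp ℂ 2 μ} (hf_bdd : MemLp f ∞ μ)
    (hf_int : ∀ᵐ x ∂μ, ∃ n : ℤ, f x = n) (hf_ann : annihilator μ f ≠ ⊥) :
    ∃ (S : Finset (ℤ × ℤ)) (e : ℤ × ℤ → ℤ × ℤ) (h : ℤ × ℤ → Lp ℂ 2 μ), (∀ g ∈ S, e g ≠ 0) ∧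
      (∀ g ∈ S, koopman μ (e g) (h g) = h g) ∧ f = ∑ g ∈ S, h g := by
  obtain ⟨p, hp, hp0⟩ := exists_mem_annihilator_coeff_zero_ne_zero hf_ann
  obtain ⟨C, hC⟩ := exists_ae_bound_laurentAct_dilate hf_bdd p
  -- every prime factor of `1 + k * N` exceeds `⌈C⌉₊`, as the primes up to `⌈C⌉₊` divide `N`
  set N := (⌈C⌉₊).factorial
  have hzero (k : ℕ) : laurentAct μ (dilate (1 + k * N) p) f = 0 := by
    refine laurentAct_dilate_eq_zero hf_int hp hC _ (by positivity) fun q hq hdvd => ?_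
    refine Nat.lt_of_ceil_lt (lt_of_not_ge fun hle => hq.one_lt.ne' ?_)
    have : q ∣ k * N := (hq.dvd_factorial.mpr hle).mul_left k
    exact Nat.dvd_one.mp ((Nat.dvd_add_left this).mp hdvd)
  have hlim := tendsto_average_laurentAct_dilate N f p
  simp only [hzero, Finset.sum_const_zero, smul_zero] at hlim
  have hsum := tendsto_nhds_unique hlim tendsto_const_nhds
  rw [Finsupp.sum, ← Finset.add_sum_erase _ _ (Finsupp.mem_support_iff.mpr hp0), smul_zero,
    koopman_zero, invariantPart_eq_self μ (koopman_zero μ f), ← Int.cast_smul_eq_zsmul ℂ] at hsum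
  refine ⟨p.coeff.support.erase 0, fun g => N • g,
    fun g => -((p.coeff 0 : ℂ)⁻¹ • p.coeff g • koopman μ g (invariantPart μ (N • g) f)), ?_, ?_, ?_⟩
  · intro g hg
    exact smul_ne_zero (Nat.factorial_ne_zero _) (Finset.ne_of_mem_erase hg)
  · intro g _
    rw [map_neg, map_smul, map_zsmul, koopman_comm, koopman_invariantPart_self]
  · rw [Finset.sum_neg_distrib, ← Finset.smul_sum, ← smul_neg, ← eq_neg_of_add_eq_zero_left hsum,
      inv_smul_smul₀ (Int.cast_ne_zero.mpr hp0)]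

/-! ### Merging proportional directions -/

/-- A finite sum of vectors fixed by nonzero elements of `ℤ²` can be rewritten with pairwise
non-proportional directions: if `q g = r d`, vectors fixed by `g` and by `d` are both fixed by the
common multiple `q g`, so their terms merge into one. -/
theorem exists_nonproportional_decomposition {ι : Type*} (S : Finset ι) (e : ι → ℤ × ℤ)
    (h : ι → Lp ℂ 2 μ) (he : ∀ i ∈ S, e i ≠ 0) (hh : ∀ i ∈ S, koopman μ (e i) (h i) = h i) :
    ∃ Δ : Finset (ℤ × ℤ), (0 : ℤ × ℤ) ∉ Δ ∧
      (∀ g ∈ Δ, ∀ g' ∈ Δ, g ≠ g' → ¬ Proportional g g') ∧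
      ∃ h' : ℤ × ℤ → Lp ℂ 2 μ, (∀ g ∈ Δ, koopman μ g (h' g) = h' g) ∧
        ∑ i ∈ S, h i = ∑ g ∈ Δ, h' g := by
  classical
  induction S using Finset.induction_on with
  | empty => exact ⟨∅, by simp, by simp, 0, by simp, by simp⟩
  | insert i S hi ih =>
    obtain ⟨Δ, hΔ0, hΔ, h', hh', hsum⟩ := ih (fun j hj => he j (Finset.mem_insert_of_mem hj))
      (fun j hj => hh j (Finset.mem_insert_of_mem hj))
    have hi0 := he i (Finset.mem_insert_self i S)
    have hhi := hh i (Finset.mem_insert_self i S)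
    -- it suffices to add a direction `d` that is not proportional to the members of a subset `Δ'`
    have extend (Δ' : Finset (ℤ × ℤ)) (hsub : Δ' ⊆ Δ) (d : ℤ × ℤ) (hd0 : d ≠ 0)
        (hd : ∀ g ∈ Δ', ¬ Proportional g d) (v : Lp ℂ 2 μ) (hv : koopman μ d v = v)
        (hs : ∑ j ∈ insert i S, h j = v + ∑ g ∈ Δ', h' g) :
        ∃ Δ : Finset (ℤ × ℤ), (0 : ℤ × ℤ) ∉ Δ ∧
          (∀ g ∈ Δ, ∀ g' ∈ Δ, g ≠ g' → ¬ Proportional g g') ∧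
          ∃ h' : ℤ × ℤ → Lp ℂ 2 μ, (∀ g ∈ Δ, koopman μ g (h' g) = h' g) ∧
            ∑ j ∈ insert i S, h j = ∑ g ∈ Δ, h' g := by
      have hdΔ : d ∉ Δ' := fun hmem => hd d hmem ⟨1, 1, one_ne_zero, one_ne_zero, rfl⟩
      have hne {g : ℤ × ℤ} (hg : g ∈ Δ') : g ≠ d := fun hgd => hdΔ (hgd ▸ hg)
      refine ⟨insert d Δ', ?_, ?_, Function.update h' d v, ?_, ?_⟩
      · rw [Finset.mem_insert, not_or]
        exact ⟨hd0.symm, fun h0 => hΔ0 (hsub h0)⟩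
      · intro g hg g' hg' hgg'
        rcases Finset.mem_insert.mp hg with h1 | h1 <;>
          rcases Finset.mem_insert.mp hg' with h2 | h2
        · exact absurd (h1.trans h2.symm) hgg'
        · exact fun hp => hd g' h2 (h1 ▸ hp.symm)
        · exact h2 ▸ hd g h1
        · exact hΔ g (hsub h1) g' (hsub h2) hgg'
      · intro g hg
        rcases Finset.mem_insert.mp hg with rfl | hg
        · simpa using hv
        · simpa [hne hg] using hh' g (hsub hg)
      · rw [Finset.sum_insert hdΔ, Function.update_self, hs]
        congr 1
        exact Finset.sum_congr rfl fun g hg => (Function.update_of_ne (hne hg) _ _).symm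
    by_cases hprop : ∃ d ∈ Δ, Proportional (e i) d
    · obtain ⟨d, hd, q, r, hq, hr, hqr⟩ := hprop
      refine extend (Δ.erase d) (Finset.erase_subset _ _) (r • d) ?_ ?_ (h i + h' d) ?_ ?_
      · exact smul_ne_zero hr fun h0 => hΔ0 (h0 ▸ hd)
      · intro g hg hp
        exact hΔ g (Finset.mem_of_mem_erase hg) d hd (Finset.ne_of_mem_erase hg)
          (hp.trans (proportional_smul_left hr d))
      · rw [map_add, koopman_zsmul_eq_self (hh' d hd), ← hqr, koopman_zsmul_eq_self hhi]
      · rw [Finset.sum_insert hi, hsum, add_assoc, Finset.add_sum_erase _ _ hd]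
    · push Not at hprop
      exact extend Δ subset_rfl (e i) hi0 (fun g hg hp => hprop g hg hp.symm) (h i) hhi
        (by rw [Finset.sum_insert hi, hsum])

/-- For `f = ∑_{g' ∈ Δ} h_{g'}` the projection of `f` to `H_{mg}` agrees with `h_g` up to a periodic
error: the projection fixes `h_g`, and sends every other `h_{g'}` to a vector fixed by the
non-proportional elements `mg` and `g'`. -/
theorem isPeriodic_invariantPart_sub {Δ : Finset (ℤ × ℤ)} (hΔ0 : (0 : ℤ × ℤ) ∉ Δ)
    (hΔ : ∀ g ∈ Δ, ∀ g' ∈ Δ, g ≠ g' → ¬ Proportional g g') {h : ℤ × ℤ → Lp ℂ 2 μ}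
    (hh : ∀ g ∈ Δ, koopman μ g (h g) = h g) {m : ℕ} (hm : m ≠ 0) {g : ℤ × ℤ} (hg : g ∈ Δ) :
    invariantPart μ (m • g) (∑ g' ∈ Δ, h g') - h g ∈ periodicSubgroup μ := by
  have hm' : (m : ℤ) ≠ 0 := Int.natCast_ne_zero.mpr hm
  have hself : invariantPart μ (m • g) (h g) = h g :=
    invariantPart_eq_self μ (by simpa using koopman_zsmul_eq_self (hh g hg) m)
  have hsum : invariantPart μ (m • g) (∑ g' ∈ Δ, h g') =
      ∑ g' ∈ Δ, invariantPart μ (m • g) (h g') := map_sum _ _ _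
  rw [hsum, ← Finset.add_sum_erase _ _ hg, hself, add_sub_cancel_left]
  refine AddSubgroup.sum_mem _ fun g' hg' => ?_
  have hg'Δ := Finset.mem_of_mem_erase hg'
  refine finiteIndex_of_mem_of_not_proportional (g := m • g) (h := g')
    (koopman_invariantPart_self μ _ _) ?_
    (smul_ne_zero hm fun h0 => hΔ0 (h0 ▸ hg)) (fun h0 => hΔ0 (h0 ▸ hg'Δ)) fun hp => ?_
  · change koopman μ g' _ = _
    rw [koopman_invariantPart, hh g' hg'Δ]
  · refine hΔ g hg g' hg'Δ (Finset.ne_of_mem_erase hg').symm (Proportional.trans ?_ hp)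
    simpa using (proportional_smul_left hm' g).symm

end

end PlaneAction

open PlaneAction in
theorem theorem3p3 {X : Type*} [MeasurableSpace X]
    [AddAction (ℤ × ℤ) X] [MeasurableConstVAdd (ℤ × ℤ) X]
    (μ : Measure X) [IsProbabilityMeasure μ] [VAddInvariantMeasure (ℤ × ℤ) X μ]
    (f : Lp ℂ 2 μ) (hf_bdd : MemLp f ∞ μ) (hf_int : ∀ᵐ x ∂μ, ∃ n : ℤ, f x = (n : ℂ))
    (hf_ann : PlaneAction.annihilator μ f ≠ ⊥) :
    ∃ Δ : Finset (ℤ × ℤ), (0 : ℤ × ℤ) ∉ Δ ∧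
      (∀ g ∈ Δ, ∀ h ∈ Δ, g ≠ h → ¬ PlaneAction.Proportional g h) ∧
      PlaneAction.IsPeriodic μ (f - ∑ g ∈ Δ, PlaneAction.invariantPart μ g f) ∧
      ∀ l : ℕ, 1 ≤ l → ∀ g ∈ Δ,
        PlaneAction.IsPeriodic μ
          (PlaneAction.invariantPart μ (l • g) f - PlaneAction.invariantPart μ g f) := by
  obtain ⟨S, e, v, he, hv, hsum⟩ := exists_eq_sum_of_annihilator_ne_bot hf_bdd hf_int hf_ann
  obtain ⟨Δ, hΔ0, hΔ, h, hh, hsum'⟩ := exists_nonproportional_decomposition S e v he hv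
  have hfh : f = ∑ g ∈ Δ, h g := hsum.trans hsum'
  have hper (l : ℕ) (hl : l ≠ 0) (g : ℤ × ℤ) (hg : g ∈ Δ) :
      invariantPart μ (l • g) f - h g ∈ periodicSubgroup μ := by
    rw [hfh]
    exact isPeriodic_invariantPart_sub hΔ0 hΔ hh hl hg
  have hper1 (g : ℤ × ℤ) (hg : g ∈ Δ) : invariantPart μ g f - h g ∈ periodicSubgroup μ := by
    simpa using hper 1 one_ne_zero g hg
  refine ⟨Δ, hΔ0, hΔ, ?_, fun l hl g hg => ?_⟩
  · have : f - ∑ g ∈ Δ, invariantPart μ g f = -∑ g ∈ Δ, (invariantPart μ g f - h g) := by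
      rw [Finset.sum_sub_distrib, ← hfh, neg_sub]
    change _ ∈ periodicSubgroup μ
    rw [this]
    exact neg_mem (AddSubgroup.sum_mem _ hper1)
  · have := sub_mem (hper l (Nat.one_le_iff_ne_zero.mp hl) g hg) (hper1 g hg)
    rwa [sub_sub_sub_cancel_right] at this
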